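/- All Banach spaces are real. For a Banach space $Z$ let $B_Z=\{z\in Z:\|z\|\le 1\}$ and $S_Z=\{z\in Z:\|z\|=1\}$, let $\mathrm{Ext}(B_Z)$ be the set of extreme points of $B_Z$, and for $z\in S_Z$ let $J(z)=\{f\in Z^*:\|f\|=1,\ f(z)=1\}$. The space $Z$ is called smooth if $J(z)$ is a singleton for every $z\in S_Z$. For a natural number $k$, a vector $z$ is called $k$-smooth if $\|z\|=1$ and $\dim\operatorname{span}J(z)=k$. For $u,v\in Z$ write $u\perp_B v$ (Birkhoff–James orthogonality) if $\|u+\lambda v\|\ge\|u\|$ for all $\lambda\in\mathbb R$. A closed subspace $M\subseteq Z$ is an $M$-ideal in $Z$ if its annihilator $M^\perp\subseteq Z^*$ is the range of a linear projection $P$ on $Z^*$ with $\|f\|=\|Pf\|+\|f-Pf\|$ for all $f\in Z^*$. Let $L(X,Y)$ be the space of bounded linear operators from $X$ to $Y$ with the operator norm, $K(X,Y)$ the subspace of compact operators, and for $T\in L(X,Y)$ let $M_T=\{x\in S_X:\|Tx\|=\|T\|\}$; $k$-smoothness of $T$ is understood in $Z=L(X,Y)$. **Theorem 2.5.** Let $X$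 be a smooth, reflexive Banach space and $Y$ an arbitrary Banach space, and suppose that $K(X,Y)$ is an $M$-ideal in $L(X,Y)$. Let $T\in L(X,Y)$ satisfy $\|T\|=1$ and $\operatorname{dist}(T,K(X,Y))<1$. Suppose that $M_T\cap\mathrm{Ext}(B_X)=\{\pm x_1,\pm x_2,\dots,\pm x_r\}$, where $x_1,\dots,x_r$ are linearly independent in $X$ and $x_i\perp_B x_j$ for all $i\ne j$. Then, for every natural number $k$, the operator $T$ is $k$-smooth if and only if there are natural numbers $m_1,\dots,m_r$ such that $Tx_i$ is $m_i$-smooth for each $1\le i\le r$ and $m_1+m_2+\dots+m_r=k$. -/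

import Mathlib

namespace KSmooth

section Defs

variable {E : Type*} [NormedAddCommGroup E] [NormedSpace ℝ E]

/-- The set `J(x)` of supporting linear functionals of `x`: the functionals of norm one in the
dual space which take the value `1` at `x`. -/
def supportSet (x : E) : Set (StrongDual ℝ E) :=
  {f | ‖f‖ = 1 ∧ f x = 1}

/-- A unit vector `x` is smooth if it has exactly one supporting linear functional. -/
def IsSmoothPoint (x : E) : Prop :=
  ‖x‖ = 1 ∧ ∃ f : StrongDual ℝ E, supportSet x = {f}

/-- A unit vector `x` is `k`-smooth if the linear span of `J(x)` has dimension exactly `k`.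
The dimension is a cardinal, so that an infinite-dimensional span is `k`-smooth for no `k`. -/
def IsKSmooth (x : E) (k : ℕ) : Prop :=
  ‖x‖ = 1 ∧ Module.rank ℝ (Submodule.span ℝ (supportSet x)) = (k : Cardinal)

/-- Birkhoff-James orthogonality of `x` to `y`. -/
def BirkhoffOrthogonal (x y : E) : Prop :=
  ∀ t : ℝ, ‖x‖ ≤ ‖x + t • y‖

/-- An M-ideal is a closed subspace whose annihilator in the dual space is the range of an
L-projection, that is, of a projection `P` with `‖f‖ = ‖P f‖ + ‖f - P f‖` for all `f`. -/
def IsMIdeal (S : Submodule ℝ E) : Prop :=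
  IsClosed (S : Set E) ∧
    ∃ P : StrongDual ℝ E →L[ℝ] StrongDual ℝ E, IsLprojection (StrongDual ℝ E) P ∧
      Set.range P = {f : StrongDual ℝ E | ∀ x ∈ S, f x = 0}

variable (E) in
/-- A normed space is smooth if all its unit vectors are smooth. -/
def IsSmoothSpace : Prop :=
  ∀ x : E, ‖x‖ = 1 → IsSmoothPoint x

variable (E) in
/-- A normed space is reflexive if the canonical map into its bidual is onto. -/
def IsReflexiveSpace : Prop :=
  Function.Surjective (NormedSpace.inclusionInDoubleDual ℝ E)

end Defs

section Operators

variable {X Y : Type*} [NormedAddCommGroup X] [NormedSpace ℝ X]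
  [NormedAddCommGroup Y] [NormedSpace ℝ Y]

variable (X Y) in
/-- The subspace of compact operators in the space of bounded linear operators. -/
def compactOperators : Submodule ℝ (X →L[ℝ] Y) :=
  compactOperator (RingHom.id ℝ) X Y

/-- The norm attainment set of a bounded linear operator. -/
def normAttainmentSet (T : X →L[ℝ] Y) : Set X :=
  {x | ‖x‖ = 1 ∧ ‖T x‖ = ‖T‖}

end Operators

end KSmooth

/-! ### Compact convex hulls and Milman's theorem. -/

section Convexity

open Set

variable {E : Type*} [AddCommGroup E] [Module ℝ E] [TopologicalSpace E]
  [IsTopologicalAddGroup E] [ContinuousSMul ℝ E]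

/-! By Krein-Milman, `J(T)` is determined by its extreme points. As `T` is at distance less than 1
from the M-ideal of compact operators, the L-projection kills `J(T)`, so extreme points of `J(T)`
restrict to extreme points of the dual ball of `K(X,Y)` (`restrict_mem_extremePoints`). By Milman's
theorem these are elementary, `S ↦ Φ (g (S ·))`; reflexivity turns `Φ` into a point `x`, necessarily
an extreme point of the ball where `T` attains its norm (`exists_eq_evalFunctional`). So only the
points `± x i` occur, and `J(T)` is the convex hull of finitely many compact convex sets `x i ⊗ J(T
(x i))`. Hence `span J(T)` is the sum of the `x i ⊗ span J(T (x i))`, direct because the `x i` are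
linearly independent (`sumEvalFunctional_injective`), and dimensions add. -/

theorem IsCompact.convexJoin {s t : Set E} (hs : IsCompact s) (ht : IsCompact t) :
    IsCompact (convexJoin ℝ s t) := by
  have h : _root_.convexJoin ℝ s t =
      (fun p : (E × E) × ℝ => p.1.1 + p.2 • (p.1.2 - p.1.1)) '' ((s ×ˢ t) ×ˢ Icc (0 : ℝ) 1) := by
    ext z
    simp only [mem_convexJoin, segment_eq_image', mem_image, Prod.exists, mem_prod]
    constructor
    · rintro ⟨a, ha, b, hb, θ, hθ, rfl⟩
      exact ⟨a, b, θ, ⟨⟨ha, hb⟩, hθ⟩, rfl⟩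
    · rintro ⟨a, b, θ, ⟨⟨ha, hb⟩, hθ⟩, rfl⟩
      exact ⟨a, ha, b, hb, θ, hθ, rfl⟩
  rw [h]
  exact ((hs.prod ht).prod isCompact_Icc).image (by fun_prop)

/-- The convex hull of a finite union of compact convex sets is compact. -/
theorem isCompact_convexHull_biUnion {ι : Type*} (t : Finset ι) (K : ι → Set E)
    (hc : ∀ i ∈ t, IsCompact (K i)) (hK : ∀ i ∈ t, Convex ℝ (K i)) :
    IsCompact (convexHull ℝ (⋃ i ∈ t, K i)) := by
  classical
  induction t using Finset.induction_on with
  | empty => simp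
  | insert a t _ ih =>
    have ih' := ih (fun i hi => hc i (Finset.mem_insert_of_mem hi))
      (fun i hi => hK i (Finset.mem_insert_of_mem hi))
    have ha := hc a (Finset.mem_insert_self _ _)
    have haK := hK a (Finset.mem_insert_self _ _)
    rw [Finset.set_biUnion_insert]
    rcases (K a).eq_empty_or_nonempty with h1 | h1
    · rwa [h1, empty_union]
    rcases (⋃ i ∈ t, K i).eq_empty_or_nonempty with h2 | h2
    · rwa [h2, union_empty, haK.convexHull_eq]
    rw [convexHull_union h1 h2, haK.convexHull_eq]
    exact ha.convexJoin ih'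

/-- **Milman's converse to the Krein-Milman theorem**. -/
theorem extremePoints_closure_convexHull_subset [T2Space E] [LocallyConvexSpace ℝ E] {A : Set E}
    (hA : IsCompact A) (hC : IsCompact (closure (convexHull ℝ A))) :
    (closure (convexHull ℝ A)).extremePoints ℝ ⊆ A := by
  intro x hx
  by_contra hxA
  have hsep : ∀ a : A, ∃ f : StrongDual ℝ E, ∃ u : ℝ, f a < u ∧ u < f x := fun a => by
    obtain ⟨f, hf⟩ := geometric_hahn_banach_point_point (E := E) (x := (a : E)) (y := x)
      (fun h => hxA (h ▸ a.2))
    obtain ⟨u, h1, h2⟩ := exists_between hf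
    exact ⟨f, u, h1, h2⟩
  choose f u hfu hux using hsep
  obtain ⟨t, ht⟩ := hA.elim_finite_subcover (fun a : A => {y | f a y < u a})
    (fun a => isOpen_lt (f a).continuous continuous_const)
    (fun a ha => mem_iUnion.2 ⟨⟨a, ha⟩, hfu ⟨a, ha⟩⟩)
  -- Finitely many half-spaces missing `x` cover `A`. The slices they cut are compact and convex, so
  -- the hull of their union needs no closure, and an extreme point of it lies in one slice.
  set K : A → Set E := fun a => closure (convexHull ℝ A) ∩ {y | f a y ≤ u a} with hKdef
  have hconv : Convex ℝ (closure (convexHull ℝ A)) := (convex_convexHull ℝ A).closure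
  have hKc : ∀ a, IsCompact (K a) := fun a =>
    hC.inter_right (isClosed_le (f a).continuous continuous_const)
  have hKv : ∀ a, Convex ℝ (K a) := fun a =>
    hconv.inter (convex_halfSpace_le (f a).toLinearMap.isLinear _)
  have hcomp := isCompact_convexHull_biUnion t K (fun a _ => hKc a) (fun a _ => hKv a)
  have hsub : A ⊆ convexHull ℝ (⋃ a ∈ t, K a) := fun y hy => by
    obtain ⟨a, ha, hya⟩ := mem_iUnion₂.1 (ht hy)
    exact subset_convexHull ℝ _ (mem_iUnion₂.2
      ⟨a, ha, subset_closure (subset_convexHull ℝ A hy), (show f a y < u a from hya).le⟩)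
  have heq : closure (convexHull ℝ A) = convexHull ℝ (⋃ a ∈ t, K a) := by
    apply Subset.antisymm
    · exact closure_minimal (convexHull_min hsub (convex_convexHull ℝ _)) hcomp.isClosed
    · exact convexHull_min (iUnion₂_subset fun a _ => inter_subset_left) hconv
  rw [heq] at hx
  obtain ⟨a, _, hxa⟩ := mem_iUnion₂.1 (extremePoints_convexHull_subset hx)
  exact absurd hxa.2 (not_le.2 (hux a))

end Convexity

namespace KSmooth

open Set Filter Topology Metric

universe u

/-! ### The dual ball of a space of operators. -/

section OperatorPairing

variable {X Y : Type*} [NormedAddCommGroup X] [NormedSpace ℝ X]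
  [NormedAddCommGroup Y] [NormedSpace ℝ Y]

/-- Composition with a compact operator is continuous from the weak-star topology on a ball of the
dual to the norm topology. -/
theorem eventually_norm_comp_sub_le {S : X →L[ℝ] Y} (hS : IsCompactOperator S)
    (g₀ : StrongDual ℝ Y) (hg₀ : ‖g₀‖ ≤ 1) {ε : ℝ} (hε : 0 < ε) :
    ∀ᶠ g in 𝓝 (StrongDual.toWeakDual g₀), ‖WeakDual.toStrongDual g‖ ≤ 1 →
      ‖(WeakDual.toStrongDual g - g₀) ∘L S‖ ≤ ε := by
  obtain ⟨C, hC, hSC⟩ := IsCompactOperator.image_closedBall_subset_compact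
    (𝕜₁ := ℝ) (f := S.toLinearMap) hS 1
  -- Since `‖g - g₀‖ ≤ 2`, an `ε / 4`-net costs `ε / 2`; closeness on its finitely many points costs
  -- the other half.
  obtain ⟨t, ht, hCt⟩ := Metric.totallyBounded_iff.1 hC.totallyBounded (ε / 4) (by positivity)
  have hev : ∀ᶠ g in 𝓝 (StrongDual.toWeakDual g₀), ∀ c ∈ t,
      |WeakDual.toStrongDual g c - g₀ c| < ε / 2 := by
    rw [ht.eventually_all]
    intro c _
    have h := (WeakDual.eval_continuous (𝕜 := ℝ) c).tendsto (StrongDual.toWeakDual g₀)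
    exact (Metric.tendsto_nhds.1 h) (ε / 2) (by positivity)
  filter_upwards [hev] with g hg hg1
  refine ContinuousLinearMap.opNorm_le_of_unit_norm hε.le fun z hz => ?_
  have hzC : S z ∈ C := hSC ⟨z, by simp [hz], rfl⟩
  obtain ⟨c, hc, hzc⟩ := mem_iUnion₂.1 (hCt hzC)
  rw [mem_ball, dist_eq_norm] at hzc
  have h1 : ‖WeakDual.toStrongDual g - g₀‖ ≤ 2 := (norm_sub_le _ _).trans (by linarith)
  have h2 : ‖(WeakDual.toStrongDual g - g₀) (S z - c)‖ ≤ 2 * (ε / 4) :=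
    ((WeakDual.toStrongDual g - g₀).le_opNorm _).trans
      (mul_le_mul h1 hzc.le (norm_nonneg _) (by norm_num))
  have h3 := hg c hc
  have h4 : ((WeakDual.toStrongDual g - g₀) ∘L S) z =
      (WeakDual.toStrongDual g - g₀) (S z - c) + (WeakDual.toStrongDual g c - g₀ c) := by
    simp only [ContinuousLinearMap.comp_apply, sub_apply, map_sub]
    ring
  rw [h4]
  calc _ ≤ ‖(WeakDual.toStrongDual g - g₀) (S z - c)‖ + |WeakDual.toStrongDual g c - g₀ c| :=
        norm_add_le _ _
    _ ≤ ε := by linarith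

section DualBall

variable (Z : Type*) [NormedAddCommGroup Z] [NormedSpace ℝ Z]

/-- The dual unit ball, as a subset of the weak dual. -/
def weakDualBall : Set (WeakDual ℝ Z) := {f | ‖WeakDual.toStrongDual f‖ ≤ 1}

theorem isCompact_weakDualBall : IsCompact (weakDualBall Z) := by
  convert WeakDual.isCompact_closedBall (𝕜 := ℝ) (E := Z) 0 1 using 1
  ext f
  simp [weakDualBall]

theorem convex_weakDualBall : Convex ℝ (weakDualBall Z) := by
  intro f hf g hg a b ha hb hab
  have h1 : ‖a • WeakDual.toStrongDual f + b • WeakDual.toStrongDual g‖ ≤ a * 1 + b * 1 :=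
    norm_add_le_of_le (by rw [norm_smul, Real.norm_of_nonneg ha]; gcongr; exact hf)
      (by rw [norm_smul, Real.norm_of_nonneg hb]; gcongr; exact hg)
  rwa [mul_one, mul_one, hab] at h1

end DualBall

instance {Z : Type*} [NormedAddCommGroup Z] [NormedSpace ℝ Z] :
    LocallyConvexSpace ℝ (WeakDual ℝ Z) :=
  inferInstanceAs (LocallyConvexSpace ℝ (WeakBilin (topDualPairing ℝ Z)))

variable {Z : Type*} [NormedAddCommGroup Z] [NormedSpace ℝ Z] (ι : Z →ₗᵢ[ℝ] (X →L[ℝ] Y))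

/-- The functional `S ↦ Φ (g ∘ S)` on a space `Z` of operators. -/
noncomputable def operatorPairing (Φ : StrongDual ℝ (StrongDual ℝ X)) (g : StrongDual ℝ Y) :
    StrongDual ℝ Z :=
  Φ ∘L (ContinuousLinearMap.compL ℝ X Y ℝ g) ∘L ι.toContinuousLinearMap

theorem norm_operatorPairing_apply_le {Φ : StrongDual ℝ (StrongDual ℝ X)} (hΦ : ‖Φ‖ ≤ 1)
    {g : StrongDual ℝ Y} (hg : ‖g‖ ≤ 1) (S : Z) :
    ‖operatorPairing ι Φ g S‖ ≤ ‖S‖ := by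
  have h1 : ‖g ∘L ι S‖ ≤ ‖S‖ :=
    ((g.opNorm_comp_le _).trans (mul_le_of_le_one_left (norm_nonneg _) hg)).trans_eq (ι.norm_map S)
  exact (Φ.le_opNorm _).trans ((mul_le_of_le_one_left (norm_nonneg _) hΦ).trans h1)

/-- The functionals `S ↦ Φ (g ∘ S)` on a space `Z` of operators with `Φ` and `g` in the unit balls. -/
def elementaryFunctionals : Set (WeakDual ℝ Z) :=
  (fun p : WeakDual ℝ (StrongDual ℝ X) × WeakDual ℝ Y =>
    StrongDual.toWeakDual (operatorPairing ι (WeakDual.toStrongDual p.1) (WeakDual.toStrongDual p.2))) ''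
    (weakDualBall (StrongDual ℝ X) ×ˢ weakDualBall Y)

/-- Compactness of `S` makes `g ↦ g ∘ S` weak-star to norm continuous on the ball, which yields
joint continuity of `(Φ, g) ↦ Φ (g ∘ S)` on the product of the two balls. -/
theorem isCompact_elementaryFunctionals (hι : ∀ z, IsCompactOperator (ι z)) :
    IsCompact (elementaryFunctionals ι) := by
  refine ((isCompact_weakDualBall _).prod (isCompact_weakDualBall _)).image_of_continuousOn ?_
  rw [continuousOn_iff_continuous_domRestrict]
  refine WeakDual.continuous_of_continuous_eval fun S => ?_
  refine ContinuousOn.domRestrict (f := fun p : WeakDual ℝ (StrongDual ℝ X) ×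
    WeakDual ℝ Y => p.1 (WeakDual.toStrongDual p.2 ∘L ι S)) ?_
  rintro ⟨Φ₀, g₀⟩ ⟨-, hg₀⟩
  refine Metric.tendsto_nhds.2 fun ε hε => ?_
  have h1 := eventually_norm_comp_sub_le (hι S) (WeakDual.toStrongDual g₀) hg₀ (half_pos hε)
  have h2 := (Metric.tendsto_nhds.1 ((WeakDual.eval_continuous (𝕜 := ℝ)
    (WeakDual.toStrongDual g₀ ∘L ι S)).tendsto Φ₀)) (ε / 2) (half_pos hε)
  have h3 := (h2.prod_nhds h1).filter_mono (nhdsWithin_le_nhds (s :=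
    weakDualBall (StrongDual ℝ X) ×ˢ weakDualBall Y))
  filter_upwards [h3, self_mem_nhdsWithin]
  rintro ⟨Φ, g⟩ ⟨hd, hc⟩ ⟨hΦ, hg⟩
  have h4 : ‖WeakDual.toStrongDual Φ
      ((WeakDual.toStrongDual g - WeakDual.toStrongDual g₀) ∘L ι S)‖ ≤ ε / 2 :=
    ((WeakDual.toStrongDual Φ).le_opNorm _).trans
      ((mul_le_of_le_one_left (norm_nonneg _) hΦ).trans (hc hg))
  rw [ContinuousLinearMap.sub_comp, map_sub] at h4
  have h5 := dist_triangle (Φ (WeakDual.toStrongDual g ∘L ι S))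
    (Φ (WeakDual.toStrongDual g₀ ∘L ι S))
    (Φ₀ (WeakDual.toStrongDual g₀ ∘L ι S))
  rw [← dist_eq_norm] at h4
  exact h5.trans_lt ((add_lt_add_of_le_of_lt h4 hd).trans_eq (add_halves ε))

theorem exists_eq_eval_weakDual {Z : Type*} [NormedAddCommGroup Z] [NormedSpace ℝ Z]
    (F : StrongDual ℝ (WeakDual ℝ Z)) : ∃ z : Z, ∀ f : WeakDual ℝ Z, F f = f z := by
  obtain ⟨z, hz⟩ := LinearMap.dualEmbedding_surjective (topDualPairing ℝ Z) F
  exact ⟨z, fun f => by rw [← hz]; rfl⟩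

/-- The dual unit ball of the space of compact operators is the weak-star closed convex hull of the
elementary functionals. -/
theorem closure_convexHull_elementaryFunctionals :
    closure (convexHull ℝ (elementaryFunctionals ι)) =
      weakDualBall Z := by
  apply Subset.antisymm
  · refine closure_minimal (convexHull_min ?_ ?_) (isCompact_weakDualBall Z).isClosed
    · rintro _ ⟨⟨Φ, g⟩, ⟨hΦ, hg⟩, rfl⟩
      exact ContinuousLinearMap.opNorm_le_bound _ zero_le_one fun S => by
        rw [one_mul]; exact norm_operatorPairing_apply_le ι hΦ hg S
    · exact convex_weakDualBall Z
  · intro f hf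
    by_contra hcon
    obtain ⟨F, u, hFu, huF⟩ := geometric_hahn_banach_closed_point
      (convex_convexHull ℝ (elementaryFunctionals ι)).closure isClosed_closure hcon
    -- The weak-star separating functional is evaluation at some `S`. Point evaluations already norm
    -- `S`, so `‖S‖ ≤ u < f S ≤ ‖S‖`.
    obtain ⟨S, hS⟩ := exists_eq_eval_weakDual F
    have h1 : f S ≤ ‖S‖ := (le_abs_self _).trans
      (((WeakDual.toStrongDual f).le_opNorm S).trans (mul_le_of_le_one_left (norm_nonneg _) hf))
    have h2 : ∀ z : X, ‖z‖ ≤ 1 → ‖ι S z‖ < u := fun z hz => by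
      obtain ⟨g, hg, hgz⟩ := exists_dual_vector'' ℝ (ι S z)
      have h3 := hFu (StrongDual.toWeakDual
        (operatorPairing ι (NormedSpace.inclusionInDoubleDual ℝ X z) g))
        (subset_closure (subset_convexHull ℝ _
          ⟨(StrongDual.toWeakDual (NormedSpace.inclusionInDoubleDual ℝ X z),
            StrongDual.toWeakDual g), ⟨?_, ?_⟩, rfl⟩))
      · rw [hS] at h3
        have h4 : g (ι S z) < u := h3
        rwa [hgz] at h4
      · exact (NormedSpace.double_dual_bound ℝ X z).trans hz
      · exact hg
    have hu : 0 ≤ u := (norm_nonneg _).trans (h2 0 (by simp)).le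
    have h5 : ‖S‖ ≤ u := (ι.norm_map S).symm.trans_le <|
      ContinuousLinearMap.opNorm_le_of_unit_norm hu fun z hz => (h2 z hz.le).le
    rw [hS] at huF
    linarith

/-- Extreme points of the dual unit ball of the space of compact operators are elementary. -/
theorem extremePoints_dual_subset_elementaryFunctionals
    (hι : ∀ z, IsCompactOperator (ι z)) :
    (weakDualBall Z).extremePoints
      ℝ ⊆ elementaryFunctionals ι := by
  rw [← closure_convexHull_elementaryFunctionals ι]
  refine extremePoints_closure_convexHull_subset (isCompact_elementaryFunctionals ι hι) ?_
  rw [closure_convexHull_elementaryFunctionals]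
  exact isCompact_weakDualBall Z

end OperatorPairing

/-! ### The support set as a weak-star compact face of the dual ball. -/

section SupportSet

variable {E : Type*} [NormedAddCommGroup E] [NormedSpace ℝ E]

/-- The set of supporting functionals, as a subset of the weak dual. -/
def weakSupportSet (x : E) : Set (WeakDual ℝ E) :=
  {f | WeakDual.toStrongDual f ∈ supportSet x}

theorem mem_supportSet_of_norm_le_one {x : E} (hx : ‖x‖ ≤ 1) {f : StrongDual ℝ E} (hf : ‖f‖ ≤ 1)
    (hfx : f x = 1) : f ∈ supportSet x := by
  refine ⟨hf.antisymm ?_, hfx⟩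
  have h := f.le_opNorm x
  rw [hfx, norm_one] at h
  exact h.trans (mul_le_of_le_one_right (norm_nonneg _) hx)

theorem weakSupportSet_eq {x : E} (hx : ‖x‖ ≤ 1) :
    weakSupportSet x = weakDualBall E ∩ {f | f x = 1} := by
  ext f
  exact ⟨fun h => ⟨h.1.le, h.2⟩, fun h => mem_supportSet_of_norm_le_one hx h.1 h.2⟩

theorem isCompact_weakSupportSet {x : E} (hx : ‖x‖ ≤ 1) : IsCompact (weakSupportSet x) := by
  rw [weakSupportSet_eq hx]
  exact (isCompact_weakDualBall E).inter_right
    (isClosed_eq (WeakDual.eval_continuous x) continuous_const)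

theorem convex_weakSupportSet {x : E} (hx : ‖x‖ ≤ 1) : Convex ℝ (weakSupportSet x) := by
  rw [weakSupportSet_eq hx]
  refine (convex_weakDualBall E).inter fun f hf g hg a b _ _ hab => ?_
  change a * f x + b * g x = 1
  rw [show f x = 1 from hf, show g x = 1 from hg, mul_one, mul_one, hab]

/-- If a convex combination of two functionals of norm at most one supports `x`, so do both. -/
theorem mem_supportSet_of_convexCombination {x : E} (hx : ‖x‖ ≤ 1) {f g : StrongDual ℝ E}
    (hf : ‖f‖ ≤ 1) (hg : ‖g‖ ≤ 1) {a b : ℝ} (ha : 0 < a) (hb : 0 < b) (hab : a + b = 1)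
    (h : a * f x + b * g x = 1) : f ∈ supportSet x ∧ g ∈ supportSet x := by
  have h1 : f x ≤ 1 := (le_abs_self _).trans ((f.le_opNorm x).trans
    (mul_le_one₀ hf (norm_nonneg _) hx))
  have h2 : g x ≤ 1 := (le_abs_self _).trans ((g.le_opNorm x).trans
    (mul_le_one₀ hg (norm_nonneg _) hx))
  exact ⟨mem_supportSet_of_norm_le_one hx hf (by nlinarith),
    mem_supportSet_of_norm_le_one hx hg (by nlinarith)⟩

end SupportSet

/-! ### Extending functionals from an M-ideal. -/

section MIdeal

variable {E Z : Type*} [NormedAddCommGroup E] [NormedSpace ℝ E] [NormedAddCommGroup Z]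
  [NormedSpace ℝ Z] {ι : Z →ₗᵢ[ℝ] E} {P : StrongDual ℝ E →L[ℝ] StrongDual ℝ E}

theorem norm_eq_of_isLprojection (hP : IsLprojection (StrongDual ℝ E) P) (f : StrongDual ℝ E) :
    ‖f‖ = ‖P f‖ + ‖f - P f‖ := hP.Lnorm f

theorem apply_eq_self_of_isLprojection (hP : IsLprojection (StrongDual ℝ E) P)
    {f : StrongDual ℝ E} (hf : f ∈ range P) : P f = f := by
  obtain ⟨g, rfl⟩ := hf
  exact congrArg (fun Q : StrongDual ℝ E →L[ℝ] StrongDual ℝ E => Q g) hP.proj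

/-- Supporting functionals at points close to an M-ideal are annihilated by the L-projection. -/
theorem apply_eq_zero_of_mem_supportSet (hP : IsLprojection (StrongDual ℝ E) P)
    (hran : range P = {f | ∀ z, f (ι z) = 0}) {x : E} (hx : ‖x‖ ≤ 1)
    (hdist : ∃ z, ‖x - ι z‖ < 1) {f : StrongDual ℝ E} (hf : f ∈ supportSet x) : P f = 0 := by
  obtain ⟨z, hz⟩ := hdist
  have h0 : P f (ι z) = 0 := by
    have h : P f ∈ range P := mem_range_self f
    rw [hran] at h
    exact h z
  -- If `P f ≠ 0`, this bound is strictly below `‖P f‖`, and then `1 = f x < ‖P f‖ + ‖f - P f‖ = 1`.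
  have h1 : P f x ≤ ‖P f‖ * ‖x - ι z‖ := by
    have h := (le_abs_self _).trans ((P f).le_opNorm (x - ι z))
    rwa [map_sub, h0, sub_zero] at h
  have h2 : (f - P f) x ≤ ‖f - P f‖ := (le_abs_self _).trans
    (((f - P f).le_opNorm x).trans (mul_le_of_le_one_right (norm_nonneg _) hx))
  rw [sub_apply, hf.2] at h2
  have h3 := norm_eq_of_isLprojection hP f
  rw [hf.1] at h3
  have h4 := norm_nonneg (P f)
  rw [← norm_eq_zero]
  nlinarith

/-- Functionals in the kernel of the L-projection are the unique norm preserving extensions of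
their restrictions to the M-ideal. -/
theorem eq_of_eqOn_of_norm_le (hP : IsLprojection (StrongDual ℝ E) P)
    (hran : range P = {f | ∀ z, f (ι z) = 0}) {f g : StrongDual ℝ E} (hf : P f = 0)
    (hfg : ∀ z, g (ι z) = f (ι z)) (hle : ‖g‖ ≤ ‖f‖) : g = f := by
  have h1 : g - f ∈ range P := by
    rw [hran]
    intro z
    rw [sub_apply, hfg, sub_self]
  -- This gives `P g = g - f`, so the norm identity reads `‖g‖ = ‖g - f‖ + ‖f‖`.
  have h2 := apply_eq_self_of_isLprojection hP h1
  rw [map_sub, hf, sub_zero] at h2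
  have h3 := norm_eq_of_isLprojection hP g
  rw [h2, sub_sub_cancel] at h3
  exact sub_eq_zero.1 (norm_eq_zero.1 (by linarith [norm_nonneg (g - f)]))

/-- Subtract `P g` from a Hahn-Banach extension `g`: this changes nothing on the ideal and does not
increase the norm. -/
theorem exists_extension_of_isLprojection (hP : IsLprojection (StrongDual ℝ E) P)
    (hran : range P = {f | ∀ z, f (ι z) = 0}) (φ : StrongDual ℝ Z) :
    ∃ f : StrongDual ℝ E, P f = 0 ∧ (∀ z, f (ι z) = φ z) ∧ ‖f‖ ≤ ‖φ‖ := by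
  obtain ⟨g, hg, hgn⟩ := exists_extension_norm_eq ι.toLinearMap.range
    (φ ∘L (ι.equivRange.symm.toContinuousLinearEquiv :
      ι.toLinearMap.range →L[ℝ] Z))
  have hgφ : ‖g‖ ≤ ‖φ‖ := by
    rw [hgn]
    refine ContinuousLinearMap.opNorm_le_bound _ (norm_nonneg _) fun y => ?_
    exact (φ.le_opNorm _).trans_eq (by simp)
  have hPg : ∀ z, P g (ι z) = 0 := by
    have h : P g ∈ range P := mem_range_self g
    rwa [hran] at h
  refine ⟨g - P g, ?_, fun z => ?_, ?_⟩
  · rw [map_sub, apply_eq_self_of_isLprojection hP (mem_range_self g), sub_self]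
  · rw [sub_apply, hPg, sub_zero]
    have h := hg (ι.equivRange z)
    simpa using h
  · have := norm_eq_of_isLprojection hP g
    linarith [norm_nonneg (P g)]

/-- Restriction to an M-ideal maps the extreme supporting functionals of a nearby point to extreme
points of the dual unit ball of the M-ideal. -/
theorem restrict_mem_extremePoints (hP : IsLprojection (StrongDual ℝ E) P)
    (hran : range P = {f | ∀ z, f (ι z) = 0}) {x : E} (hx : ‖x‖ ≤ 1)
    (hdist : ∃ z, ‖x - ι z‖ < 1) {f : WeakDual ℝ E}
    (hf : f ∈ (weakSupportSet x).extremePoints ℝ) :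
    StrongDual.toWeakDual (WeakDual.toStrongDual f ∘L ι.toContinuousLinearMap) ∈
      (weakDualBall Z).extremePoints ℝ := by
  obtain ⟨hfJ, hfext⟩ := hf
  have hfP := apply_eq_zero_of_mem_supportSet hP hran hx hdist hfJ
  refine ⟨?_, ?_⟩
  · refine ContinuousLinearMap.opNorm_le_bound _ zero_le_one fun z => ?_
    have h := (WeakDual.toStrongDual f).le_opNorm (ι z)
    rwa [hfJ.1, ι.norm_map] at h
  · rintro φ₁ hφ₁ φ₂ hφ₂ ⟨a, b, ha, hb, hab, hφ⟩
    obtain ⟨g₁, hg₁P, hg₁, hg₁n⟩ := exists_extension_of_isLprojection hP hran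
      (WeakDual.toStrongDual φ₁)
    obtain ⟨g₂, hg₂P, hg₂, hg₂n⟩ := exists_extension_of_isLprojection hP hran
      (WeakDual.toStrongDual φ₂)
    have hn₁ : ‖g₁‖ ≤ 1 := hg₁n.trans hφ₁
    have hn₂ : ‖g₂‖ ≤ 1 := hg₂n.trans hφ₂
    -- A decomposition of the restriction lifts to one of `f`, by uniqueness of norm-preserving
    -- extensions.
    have hsum : a • g₁ + b • g₂ = WeakDual.toStrongDual f := by
      refine eq_of_eqOn_of_norm_le hP hran hfP (fun z => ?_) ?_
      · have h := DFunLike.congr_fun hφ z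
        change a * g₁ (ι z) + b * g₂ (ι z) = _
        rw [hg₁, hg₂]
        exact h
      · rw [hfJ.1, ← hab]
        refine norm_add_le_of_le ?_ ?_
        · rw [norm_smul, Real.norm_of_nonneg ha.le]
          exact mul_le_of_le_one_right ha.le hn₁
        · rw [norm_smul, Real.norm_of_nonneg hb.le]
          exact mul_le_of_le_one_right hb.le hn₂
    obtain ⟨h₁, h₂⟩ := mem_supportSet_of_convexCombination hx hn₁ hn₂ ha hb hab
      (by rw [← hfJ.2, ← hsum]; rfl)
    have heq := hfext (x₁ := StrongDual.toWeakDual g₁) h₁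
      (x₂ := StrongDual.toWeakDual g₂) h₂ ⟨a, b, ha, hb, hab, hsum⟩
    have heq' : g₁ = WeakDual.toStrongDual f := heq
    refine DFunLike.ext _ _ fun z => ?_
    change WeakDual.toStrongDual φ₁ z = WeakDual.toStrongDual f (ι z)
    rw [← hg₁, heq']

end MIdeal

/-! ### Evaluation functionals, extreme points of `J(T)` and the dimension count. -/

section Operators

variable {X Y : Type*} [NormedAddCommGroup X] [NormedSpace ℝ X]
  [NormedAddCommGroup Y] [NormedSpace ℝ Y]

variable (Y) in
/-- The functional `T ↦ g (T x)` on operators, as a linear function of `g`. -/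
noncomputable def evalFunctional (x : X) : StrongDual ℝ Y →ₗ[ℝ] StrongDual ℝ (X →L[ℝ] Y) where
  toFun g := g ∘L ContinuousLinearMap.apply ℝ Y x
  map_add' _ _ := rfl
  map_smul' _ _ := rfl

@[simp]
theorem evalFunctional_apply (x : X) (g : StrongDual ℝ Y) (T : X →L[ℝ] Y) :
    evalFunctional Y x g T = g (T x) := rfl

theorem evalFunctional_neg (x : X) (g : StrongDual ℝ Y) :
    evalFunctional Y (-x) g = evalFunctional Y x (-g) := by
  ext T
  simp

theorem norm_evalFunctional_le {x : X} (hx : ‖x‖ ≤ 1) {g : StrongDual ℝ Y} (hg : ‖g‖ ≤ 1) :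
    ‖evalFunctional Y x g‖ ≤ 1 := by
  refine ContinuousLinearMap.opNorm_le_bound _ zero_le_one fun T => ?_
  rw [one_mul]
  exact (g.le_opNorm _).trans ((mul_le_of_le_one_left (norm_nonneg _) hg).trans
    ((T.le_opNorm x).trans (mul_le_of_le_one_right (norm_nonneg _) hx)))

theorem evalFunctional_mem_supportSet {T : X →L[ℝ] Y} (hT : ‖T‖ ≤ 1) {x : X} (hx : ‖x‖ ≤ 1)
    {g : StrongDual ℝ Y} (hg : g ∈ supportSet (T x)) : evalFunctional Y x g ∈ supportSet T :=
  mem_supportSet_of_norm_le_one hT (norm_evalFunctional_le hx hg.1.le) hg.2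

/-- Test on the rank-one operators `φ ⊗ v` with `g v ≠ 0`. -/
theorem eq_of_evalFunctional_eq {g : StrongDual ℝ Y} (hg : g ≠ 0) {x y : X}
    (h : evalFunctional Y x g = evalFunctional Y y g) : x = y := by
  obtain ⟨v, hv⟩ : ∃ v, g v ≠ 0 := by
    by_contra! hcon
    exact hg (ContinuousLinearMap.ext hcon)
  refine (SeparatingDual.eq_iff_forall_dual_eq (R := ℝ)).2 fun φ => ?_
  have h1 := DFunLike.congr_fun h (φ.smulRight v)
  simpa [hv] using h1

/-- Let a space of compact operators be an M-ideal and let `X` be reflexive. The extreme supporting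
functionals of an operator `T` of norm one which is close to the M-ideal are of the form
`S ↦ g (S x)`, where `x` is an extreme point of the unit ball at which `T` attains its norm. -/
theorem exists_eq_evalFunctional_of_isLprojection (hrefl : IsReflexiveSpace X)
    {Z : Type*} [NormedAddCommGroup Z] [NormedSpace ℝ Z] {ι : Z →ₗᵢ[ℝ] (X →L[ℝ] Y)}
    (hι : ∀ z, IsCompactOperator (ι z))
    {P : StrongDual ℝ (X →L[ℝ] Y) →L[ℝ] StrongDual ℝ (X →L[ℝ] Y)}
    (hP : IsLprojection (StrongDual ℝ (X →L[ℝ] Y)) P) (hran : range P = {f | ∀ z, f (ι z) = 0})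
    {T : X →L[ℝ] Y} (hT : ‖T‖ = 1) (hdist : ∃ z, ‖T - ι z‖ < 1)
    {f : WeakDual ℝ (X →L[ℝ] Y)} (hf : f ∈ (weakSupportSet T).extremePoints ℝ) :
    ∃ x ∈ normAttainmentSet T ∩ extremePoints ℝ (closedBall (0 : X) 1), ∃ g ∈ supportSet (T x),
      WeakDual.toStrongDual f = evalFunctional Y x g := by
  have hfP := apply_eq_zero_of_mem_supportSet hP hran hT.le hdist hf.1
  obtain ⟨⟨Φ, g⟩, ⟨hΦ, hg⟩, hΦg⟩ := extremePoints_dual_subset_elementaryFunctionals _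
    hι (restrict_mem_extremePoints hP hran hT.le hdist hf)
  obtain ⟨x, hx⟩ := hrefl (WeakDual.toStrongDual Φ)
  set g' := WeakDual.toStrongDual g
  have hg1 : ‖g'‖ ≤ 1 := hg
  have hx1 : ‖x‖ ≤ 1 := by
    rw [← (NormedSpace.inclusionInDoubleDualLi ℝ (E := X)).norm_map x]
    exact (congrArg norm hx).trans_le hΦ
  have heq : evalFunctional Y x g' = WeakDual.toStrongDual f := by
    refine eq_of_eqOn_of_norm_le hP hran hfP (fun z => ?_) ?_
    · have h1 := DFunLike.congr_fun hΦg z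
      have h2 : WeakDual.toStrongDual Φ (g' ∘L ι z) = f (ι z) := h1
      rw [← hx] at h2
      exact h2
    · rw [hf.1.1]
      exact norm_evalFunctional_le hx1 hg1
  have hgT : g' (T x) = 1 := by
    rw [← evalFunctional_apply, heq]
    exact hf.1.2
  have hle : ∀ y : X, ‖y‖ ≤ 1 → ‖T y‖ ≤ ‖y‖ := fun y _ => by
    simpa [hT] using T.le_opNorm y
  have h1 : 1 ≤ ‖T x‖ := by
    rw [← hgT]
    exact (le_abs_self _).trans ((g'.le_opNorm _).trans (mul_le_of_le_one_left (norm_nonneg _) hg1))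
  have hxn : ‖x‖ = 1 := hx1.antisymm (h1.trans (hle x hx1))
  have hTx : ‖T x‖ = 1 := ((hle x hx1).trans hx1).antisymm h1
  have hg0 : g' ≠ 0 := fun h => by simp [h] at hgT
  refine ⟨x, ⟨⟨hxn, hTx.trans hT.symm⟩, by simpa using hx1, ?_⟩, g',
    mem_supportSet_of_norm_le_one hTx.le hg1 hgT, heq.symm⟩
  -- Splitting `x` splits `f` inside `J(T)`, so extremality of `f` forces `u = x`.
  rintro u hu v hv ⟨a, b, ha, hb, hab, hxab⟩
  have hu1 : ‖u‖ ≤ 1 := by simpa using hu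
  have hv1 : ‖v‖ ≤ 1 := by simpa using hv
  have hcomb : a • evalFunctional Y u g' + b • evalFunctional Y v g' = evalFunctional Y x g' := by
    ext S
    simp [← hxab]
  obtain ⟨hJu, hJv⟩ := mem_supportSet_of_convexCombination hT.le (norm_evalFunctional_le hu1 hg1)
    (norm_evalFunctional_le hv1 hg1) ha hb hab (by
      rw [← hgT, ← evalFunctional_apply x g' T, ← hcomb]; rfl)
  have h2 := hf.2 (x₁ := StrongDual.toWeakDual (evalFunctional Y u g')) hJu
    (x₂ := StrongDual.toWeakDual (evalFunctional Y v g')) hJv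
    ⟨a, b, ha, hb, hab, hcomb.trans heq⟩
  have h3 : evalFunctional Y u g' = WeakDual.toStrongDual f := h2
  exact eq_of_evalFunctional_eq hg0 (h3.trans heq.symm)

theorem exists_linearIsometry_range_eq {E : Type u} [NormedAddCommGroup E] [NormedSpace ℝ E]
    (K : Submodule ℝ E) : ∃ (Z : Type u) (_ : NormedAddCommGroup Z) (_ : NormedSpace ℝ Z)
      (ι : Z →ₗᵢ[ℝ] E), range ι = K :=
  ⟨K, inferInstance, inferInstance, K.subtypeₗᵢ, by ext; simp⟩

/-- Let the compact operators be an M-ideal and let `X` be reflexive. The extreme supporting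
functionals of an operator `T` of norm one which is close to the compact operators are of the form
`S ↦ g (S x)`, where `x` is an extreme point of the unit ball at which `T` attains its norm. -/
theorem exists_eq_evalFunctional (hrefl : IsReflexiveSpace X)
    (hideal : IsMIdeal (compactOperators X Y)) {T : X →L[ℝ] Y} (hT : ‖T‖ = 1)
    (hdist : infDist T (compactOperators X Y : Set (X →L[ℝ] Y)) < 1)
    {f : WeakDual ℝ (X →L[ℝ] Y)} (hf : f ∈ (weakSupportSet T).extremePoints ℝ) :
    ∃ x ∈ normAttainmentSet T ∩ extremePoints ℝ (closedBall (0 : X) 1), ∃ g ∈ supportSet (T x),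
      WeakDual.toStrongDual f = evalFunctional Y x g := by
  obtain ⟨-, P, hP, hran⟩ := hideal
  obtain ⟨Z, _, _, ι, hZ⟩ := exists_linearIsometry_range_eq (compactOperators X Y)
  have hmem : ∀ S, S ∈ compactOperators X Y ↔ S ∈ range ι := fun S => by rw [hZ]; rfl
  have hran' : range P = {f | ∀ z, f (ι z) = 0} := by
    rw [hran]
    ext f
    simp [hmem]
  have hdist' : ∃ z, ‖T - ι z‖ < 1 := by
    obtain ⟨S, hS, hTS⟩ := (infDist_lt_iff ⟨0, (compactOperators X Y).zero_mem⟩).1 hdist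
    obtain ⟨z, rfl⟩ := (hmem S).1 hS
    exact ⟨z, by rwa [dist_eq_norm] at hTS⟩
  exact exists_eq_evalFunctional_of_isLprojection hrefl
    (fun z => (hmem (ι z)).2 (mem_range_self z)) hP hran' hT hdist' hf

/-- The functionals `S ↦ g (S x)` with `g` supporting `T x`. -/
def evalSupportSet (T : X →L[ℝ] Y) (x : X) : Set (WeakDual ℝ (X →L[ℝ] Y)) :=
  (fun g : WeakDual ℝ Y => StrongDual.toWeakDual (evalFunctional Y x (WeakDual.toStrongDual g))) ''
    weakSupportSet (T x)

theorem isCompact_evalSupportSet {T : X →L[ℝ] Y} {x : X} (hx : ‖T x‖ ≤ 1) :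
    IsCompact (evalSupportSet T x) :=
  (isCompact_weakSupportSet hx).image (WeakDual.continuous_of_continuous_eval fun S =>
    WeakDual.eval_continuous (S x))

theorem convex_evalSupportSet {T : X →L[ℝ] Y} {x : X} (hx : ‖T x‖ ≤ 1) :
    Convex ℝ (evalSupportSet T x) :=
  (convex_weakSupportSet hx).linear_image
    (StrongDual.toWeakDual.toLinearMap ∘ₗ evalFunctional Y x ∘ₗ WeakDual.toStrongDual.toLinearMap)

/-- If all the extreme supporting functionals of `T` are evaluations at finitely many points, then
`J(T)` is the convex hull of the sets of evaluations at these points. -/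
theorem weakSupportSet_subset_convexHull {T : X →L[ℝ] Y} (hT : ‖T‖ ≤ 1) {ι : Type*} [Fintype ι]
    {x : ι → X} (hx : ∀ i, ‖T (x i)‖ ≤ 1)
    (hext : (weakSupportSet T).extremePoints ℝ ⊆ ⋃ i, evalSupportSet T (x i)) :
    weakSupportSet T ⊆ convexHull ℝ (⋃ i, evalSupportSet T (x i)) := by
  have hc := isCompact_convexHull_biUnion Finset.univ (fun i => evalSupportSet T (x i))
    (fun i _ => isCompact_evalSupportSet (hx i)) (fun i _ => convex_evalSupportSet (hx i))
  simp only [Finset.mem_univ, iUnion_true] at hc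
  rw [← closure_convexHull_extremePoints (isCompact_weakSupportSet hT) (convex_weakSupportSet hT)]
  exact closure_minimal (convexHull_mono hext) hc.isClosed

/-- The sum of evaluation functionals at a family of points. -/
noncomputable def sumEvalFunctional {ι : Type*} [Fintype ι] (x : ι → X)
    (V : ι → Submodule ℝ (StrongDual ℝ Y)) : (∀ i, V i) →ₗ[ℝ] StrongDual ℝ (X →L[ℝ] Y) :=
  ∑ i, evalFunctional Y (x i) ∘ₗ (V i).subtype ∘ₗ LinearMap.proj i

theorem sumEvalFunctional_apply {ι : Type*} [Fintype ι] (x : ι → X)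
    (V : ι → Submodule ℝ (StrongDual ℝ Y)) (g : ∀ i, V i) :
    sumEvalFunctional x V g = ∑ i, evalFunctional Y (x i) (g i : StrongDual ℝ Y) := by
  simp [sumEvalFunctional]

theorem exists_dual_eq_single {ι : Type*} [Finite ι] [DecidableEq ι] {x : ι → X}
    (hx : LinearIndependent ℝ x) (i : ι) :
    ∃ φ : StrongDual ℝ X, ∀ j, φ (x j) = if j = i then 1 else 0 := by
  have := FiniteDimensional.span_of_finite ℝ (finite_range x)
  let b := Module.Basis.span hx
  obtain ⟨φ, hφ, -⟩ := exists_extension_norm_eq (Submodule.span ℝ (range x))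
    (LinearMap.toContinuousLinearMap (b.coord i))
  refine ⟨φ, fun j => ?_⟩
  have h := hφ (b j)
  have hb : (b j : X) = x j := congrArg Subtype.val (Module.Basis.span_apply hx j)
  rw [hb] at h
  rw [h]
  simp [Finsupp.single_apply]

/-- The operators `φ ⊗ y`, with `φ` equal to 1 at `x i` and 0 at the other points, isolate the
`i`-th component. -/
theorem sumEvalFunctional_injective {ι : Type*} [Fintype ι] {x : ι → X}
    (hx : LinearIndependent ℝ x) (V : ι → Submodule ℝ (StrongDual ℝ Y)) :
    Function.Injective (sumEvalFunctional x V) := by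
  classical
  intro g g' hg
  funext i
  obtain ⟨φ, hφ⟩ := exists_dual_eq_single hx i
  refine Subtype.ext (ContinuousLinearMap.ext fun y => ?_)
  have h := DFunLike.congr_fun hg (φ.smulRight y)
  rw [sumEvalFunctional_apply, sumEvalFunctional_apply] at h
  simpa [hφ, sum_apply, ite_smul, apply_ite] using h

theorem rank_eq_natCast_iff_of_pi {ι : Type*} [Fintype ι] {V : Type*} [AddCommGroup V] [Module ℝ V]
    {W : ι → Type*} [∀ i, AddCommGroup (W i)] [∀ i, Module ℝ (W i)] (e : (∀ i, W i) ≃ₗ[ℝ] V)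
    (k : ℕ) : Module.rank ℝ V = k ↔
      ∃ m : ι → ℕ, (∀ i, Module.rank ℝ (W i) = m i) ∧ ∑ i, m i = k := by
  constructor
  · intro h
    have hV : Module.Finite ℝ V := by
      rw [← Module.rank_lt_aleph0_iff, h]
      exact Cardinal.natCast_lt_aleph0
    have hpi : Module.Finite ℝ (∀ i, W i) := Module.Finite.equiv e.symm
    have hW : ∀ i, Module.Finite ℝ (W i) := fun i =>
      Module.Finite.of_surjective (LinearMap.proj (R := ℝ) (φ := W) i)
        (LinearMap.proj_surjective i)
    refine ⟨fun i => Module.finrank ℝ (W i), fun i => (Module.finrank_eq_rank ℝ (W i)).symm, ?_⟩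
    rw [← Module.finrank_eq_rank, Nat.cast_inj, ← e.finrank_eq, Module.finrank_pi_fintype] at h
    exact h
  · rintro ⟨m, hm, rfl⟩
    have hW : ∀ i, Module.Finite ℝ (W i) := fun i => by
      rw [← Module.rank_lt_aleph0_iff, hm]
      exact Cardinal.natCast_lt_aleph0
    have hV : Module.Finite ℝ V := Module.Finite.equiv e
    rw [← Module.finrank_eq_rank, ← e.finrank_eq, Module.finrank_pi_fintype]
    exact congrArg _ (Finset.sum_congr rfl fun i _ => Module.finrank_eq_of_rank_eq (hm i))

theorem range_sumEvalFunctional {T : X →L[ℝ] Y} (hT : ‖T‖ ≤ 1) {ι : Type*} [Fintype ι]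
    {x : ι → X} (hx : ∀ i, ‖x i‖ ≤ 1)
    (hext : (weakSupportSet T).extremePoints ℝ ⊆ ⋃ i, evalSupportSet T (x i)) :
    (sumEvalFunctional x fun i => Submodule.span ℝ (supportSet (T (x i)))).range =
      Submodule.span ℝ (supportSet T) := by
  classical
  have hTx : ∀ i, ‖T (x i)‖ ≤ 1 := fun i =>
    (T.le_opNorm _).trans (mul_le_one₀ hT (norm_nonneg _) (hx i))
  apply le_antisymm
  · rintro _ ⟨g, rfl⟩
    rw [sumEvalFunctional_apply]
    refine Submodule.sum_mem _ fun i _ => ?_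
    have h : Submodule.span ℝ (supportSet (T (x i))) ≤
        (Submodule.span ℝ (supportSet T)).comap (evalFunctional Y (x i)) :=
      Submodule.span_le.2 fun f hf =>
        Submodule.subset_span (evalFunctional_mem_supportSet hT (hx i) hf)
    exact h (g i).2
  · rw [Submodule.span_le]
    intro f hf
    have h1 := weakSupportSet_subset_convexHull hT hTx hext
      (show StrongDual.toWeakDual f ∈ weakSupportSet T from hf)
    set R := (sumEvalFunctional x fun i => Submodule.span ℝ (supportSet (T (x i)))).range
    have h2 : convexHull ℝ (⋃ i, evalSupportSet T (x i)) ⊆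
        (R.comap WeakDual.toStrongDual.toLinearMap : Set (WeakDual ℝ (X →L[ℝ] Y))) := by
      refine convexHull_min (iUnion_subset fun i => ?_) (Submodule.convex _)
      rintro _ ⟨g, hg, rfl⟩
      refine ⟨Pi.single i ⟨WeakDual.toStrongDual g, Submodule.subset_span hg⟩, ?_⟩
      rw [sumEvalFunctional_apply, Finset.sum_eq_single i]
      · rw [Pi.single_eq_same]; rfl
      · intro j _ hj
        rw [Pi.single_eq_of_ne hj]
        exact map_zero _
      · simp
    exact h2 h1

end Operators

end KSmooth

theorem theorem2p5
    {X Y : Type*} [NormedAddCommGroup X] [NormedSpace ℝ X] [CompleteSpace X]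
    [NormedAddCommGroup Y] [NormedSpace ℝ Y] [CompleteSpace Y]
    (hsmooth : KSmooth.IsSmoothSpace X) (hrefl : KSmooth.IsReflexiveSpace X)
    (hideal : KSmooth.IsMIdeal (KSmooth.compactOperators X Y))
    (T : X →L[ℝ] Y) (hT : ‖T‖ = 1)
    (hdist : Metric.infDist T (KSmooth.compactOperators X Y : Set (X →L[ℝ] Y)) < 1)
    (r : ℕ) (x : Fin r → X)
    (hM : KSmooth.normAttainmentSet T ∩ Set.extremePoints ℝ (Metric.closedBall (0 : X) 1) =
      {z | ∃ i, z = x i ∨ z = -x i})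
    (hli : LinearIndependent ℝ x)
    (horth : ∀ i j, i ≠ j → KSmooth.BirkhoffOrthogonal (x i) (x j))
    (k : ℕ) :
    KSmooth.IsKSmooth T k ↔
      ∃ m : Fin r → ℕ, (∀ i, KSmooth.IsKSmooth (T (x i)) (m i)) ∧ ∑ i, m i = k := by

  have hxM : ∀ i, x i ∈ KSmooth.normAttainmentSet T := fun i => by
    have h : x i ∈ {z | ∃ i, z = x i ∨ z = -x i} := ⟨i, Or.inl rfl⟩
    rw [← hM] at h
    exact h.1
  have hext : Set.extremePoints ℝ (KSmooth.weakSupportSet T) ⊆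
      ⋃ i, KSmooth.evalSupportSet T (x i) := by
    intro f hf
    obtain ⟨z, hz, g, hg, hfg⟩ := KSmooth.exists_eq_evalFunctional hrefl hideal hT hdist hf
    rw [hM] at hz
    obtain ⟨i, rfl | rfl⟩ := hz
    · exact Set.mem_iUnion.2 ⟨i, StrongDual.toWeakDual g, hg, hfg.symm⟩
    -- Evaluating `g` at `-x i` is evaluating `-g` at `x i`, so antipodal points contribute the same
    -- functionals.
    · refine Set.mem_iUnion.2 ⟨i, StrongDual.toWeakDual (-g), ⟨?_, ?_⟩, ?_⟩
      · exact (norm_neg g).trans hg.1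
      · have h := hg.2
        rw [map_neg, map_neg] at h
        exact h
      · exact (KSmooth.evalFunctional_neg (x i) g).symm.trans hfg.symm
  have hran := KSmooth.range_sumEvalFunctional hT.le (fun i => (hxM i).1.le) hext
  have key := KSmooth.rank_eq_natCast_iff_of_pi
    (V := Submodule.span ℝ (KSmooth.supportSet T))
    (W := fun i => Submodule.span ℝ (KSmooth.supportSet (T (x i))))
    ((LinearEquiv.ofInjective _ (KSmooth.sumEvalFunctional_injective hli fun i =>
      Submodule.span ℝ (KSmooth.supportSet (T (x i))))).trans (LinearEquiv.ofEq _ _ hran)) k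
  -- Since `‖T (x i)‖ = ‖T‖ = 1`, only the rank conditions remain.
  simp only [KSmooth.IsKSmooth, hT, true_and, (hxM _).2]
  exact key
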